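/- Let $\Omega$ be a metrizable locally compact space, let $\Omega\cup\{\infty\}$ be its one-point compactification (if $\Omega$ is compact, $\infty$ is an isolated point), and let $C(\Omega)$ and $C_0(\Omega)$ be the algebras of all continuous functions on $\Omega$ and of those vanishing at infinity, with scalars $\mathbb R$ or $\mathbb C$. For a compact space $X$ let $X^{(1)}$ be the set of limit points of $X$, let $X^{(n+1)}$ be the set of limit points of $X^{(n)}$ for $n\ge 1$, and let $X^{(\infty)}=\bigcap_{n\ge 1}X^{(n)}$. For $f\in C(\Omega)$ put $\mathbf Z(f)=\{x\in\Omega: f(x)=0\}$, and let $\mathbf Z[\Omega]=\{\mathbf Z(f): f\in C(\Omega)\}$. A *$z$-filter* on $\Omega$ is a non-empty proper subset of $\mathbf Z[\Omega]$ closed under finite intersections and under supersets in $\mathbf Z[\Omega]$. A $z$-filter $\mathcal P$ is *prime* if $Z_1\cup Z_2\notin\mathcal P$ whenever $Z_1,Z_2\in\mathbf Z[\Omega]\setminus\mathcal P$. A prime $z$-filter $\mathcal P$ is *supported at* $x\in\Omega$ if $x\in Z$ for all $Z\in\mathcal P$, and *supported at $\infty$* if there is no such $x\in\Omega$. A *prime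 $z$-ideal* of $C_0(\Omega)$ is a proper ideal $P$ such that $fg\in P$ implies $f\in P$ or $g\in P$, and such that $g\in P$ whenever $g\in C_0(\Omega)$ and $\mathbf Z(g)\supseteq\mathbf Z(f)$ for some $f\in P$. It is *supported at* $x\in\Omega$ if $f(x)=0$ for all $f\in P$, and *supported at $\infty$* if there is no such $x\in\Omega$. Identify the cardinal $\mathfrak c=2^{\aleph_0}$ with the least ordinal of cardinality $\mathfrak c$. **Theorem.** Let $p\in(\Omega\cup\{\infty\})^{(\infty)}$. Then there is a family $(\mathcal Q_\alpha)_{\alpha<\mathfrak c}$ of prime $z$-filters on $\Omega$, each supported at $p$, such that $\mathcal Q_\beta\subsetneq\mathcal Q_\alpha$ whenever $\alpha<\beta<\mathfrak c$. Furthermore, the sets $Q_\alpha=\{f\in C_0(\Omega):\mathbf Z(f)\in\mathcal Q_\alpha\}$, $\alpha<\mathfrak c$, are prime $z$-ideals of $C_0(\Omega)$, each supported at $p$, and $Q_\beta\subsetneq Q_\alpha$ whenever $\alpha<\beta<\mathfrak c$. -/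

import Mathlib

open Set
open scoped OnePoint ZeroAtInfty

/-- The `n`-th level `X^(n)` of a space `X`: `X^(0) = X`, and `X^(n+1)` is the set of limit points
of `X^(n)`. The sets `X^(n)` are closed (when `X` is T₁), so it does not matter whether the limit
points of `X^(n)` are taken in `X` or in the subspace `X^(n)`. -/
def cbLevel (X : Type*) [TopologicalSpace X] : ℕ → Set X
  | 0 => univ
  | n + 1 => derivedSet (cbLevel X n)

/-- `X^(∞)`, the intersection of the levels `X^(n)`, `n ≥ 1`. -/
def cbLevelInfty (X : Type*) [TopologicalSpace X] : Set X :=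
  ⋂ n : ℕ, cbLevel X (n + 1)

section ZSets

variable (𝕜 : Type*) [RCLike 𝕜] {Ω : Type*} [TopologicalSpace Ω]

/-- The zero set `Z(f)` of a scalar-valued function. -/
def zeroSet {𝕜 : Type*} [RCLike 𝕜] {Ω : Type*} (f : Ω → 𝕜) : Set Ω :=
  {x | f x = 0}

variable (Ω) in
/-- `Z[Ω]`, the collection of all zero sets of continuous functions on `Ω`. -/
def zeroSets : Set (Set Ω) :=
  {Z | ∃ f : C(Ω, 𝕜), Z = zeroSet f}

/-- A `z`-filter: a non-empty proper subset of `Z[Ω]` that is closed under finite intersections and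
under supersets in `Z[Ω]`. -/
structure IsZFilter (F : Set (Set Ω)) : Prop where
  nonempty : F.Nonempty
  ssubset : F ⊂ zeroSets 𝕜 Ω
  inter_mem : ∀ Z₁ ∈ F, ∀ Z₂ ∈ F, Z₁ ∩ Z₂ ∈ F
  mem_of_superset : ∀ Z₁ ∈ F, ∀ Z₂ ∈ zeroSets 𝕜 Ω, Z₁ ⊆ Z₂ → Z₂ ∈ F

/-- A prime `z`-filter: the union of two zero sets outside of it is outside of it. -/
structure IsPrimeZFilter (F : Set (Set Ω)) : Prop extends IsZFilter 𝕜 F where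
  union_notMem : ∀ Z₁ ∈ zeroSets 𝕜 Ω \ F, ∀ Z₂ ∈ zeroSets 𝕜 Ω \ F, Z₁ ∪ Z₂ ∉ F

/-- `Z⁻¹[F]`, the set of continuous functions on `Ω` whose zero set belongs to `F`. -/
def zInv (F : Set (Set Ω)) : Set C(Ω, 𝕜) :=
  {f | zeroSet f ∈ F}

/-- `C₀(Ω) ∩ Z⁻¹[F]`, as a subset of `C₀(Ω)`. -/
def zInvC₀ (F : Set (Set Ω)) : Set C₀(Ω, 𝕜) :=
  {f | f.toContinuousMap ∈ zInv 𝕜 F}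

end ZSets

/-- Support of a prime `z`-filter: it is supported at the point `x` of `Ω` if `x` lies in all its
members, and at infinity if no point of `Ω` lies in all its members. -/
def ZFilterSupportedAt {Ω : Type*} (F : Set (Set Ω)) : OnePoint Ω → Prop
  | ∞ => ¬ ∃ x : Ω, ∀ Z ∈ F, x ∈ Z
  | OnePoint.some x => ∀ Z ∈ F, x ∈ Z

section Ideals

variable {𝕜 : Type*} [RCLike 𝕜] {Ω : Type*} [TopologicalSpace Ω]

/-- `I` is an ideal of the (commutative, possibly non-unital) algebra `C₀(Ω)`. -/
structure IsC₀Ideal (I : Set C₀(Ω, 𝕜)) : Prop where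
  zero_mem : 0 ∈ I
  add_mem : ∀ f ∈ I, ∀ g ∈ I, f + g ∈ I
  smul_mem : ∀ (c : 𝕜), ∀ f ∈ I, c • f ∈ I
  mul_mem : ∀ (g : C₀(Ω, 𝕜)), ∀ f ∈ I, g * f ∈ I

/-- A prime ideal of `C₀(Ω)`: a proper ideal `I` such that `f * g ∈ I` implies `f ∈ I` or
`g ∈ I`. -/
structure IsPrimeC₀Ideal (I : Set C₀(Ω, 𝕜)) : Prop extends IsC₀Ideal I where
  ne_univ : I ≠ univ
  mem_or_mem : ∀ f g : C₀(Ω, 𝕜), f * g ∈ I → f ∈ I ∨ g ∈ I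

/-- A prime `z`-ideal of `C₀(Ω)`: a prime ideal `I` such that `g ∈ I` whenever `Z(f) ⊆ Z(g)` for
some `f ∈ I`. -/
structure IsPrimeZIdeal (I : Set C₀(Ω, 𝕜)) : Prop extends IsPrimeC₀Ideal I where
  mem_of_zeroSet_subset : ∀ f ∈ I, ∀ g : C₀(Ω, 𝕜), zeroSet f ⊆ zeroSet g → g ∈ I

/-- Support of a prime ideal of `C₀(Ω)`: it is supported at the point `x` of `Ω` if all its members
vanish at `x`, and at infinity if its members have no common zero in `Ω`. -/
def IdealSupportedAt (P : Set C₀(Ω, 𝕜)) : OnePoint Ω → Prop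
  | ∞ => ¬ ∃ x : Ω, ∀ f ∈ P, f x = 0
  | OnePoint.some x => ∀ f ∈ P, f x = 0

end Ideals

/-!
A limit of prime `z`-filters along an ultrafilter is again a prime `z`-filter, and it is supported
at the limit of their support points. A prime `z`-filter supported at `x` only depends on germs of
closed sets at `x`; so if the support points have disjoint compact neighbourhoods, a single function
in `C₀(Ω)` whose zero set has prescribed germs at all of them separates the limits of two strictly
nested families. By induction on `m`, every point of `X^(m)`, `X = Ω ∪ {∞}`, other than `∞` supports
a strictly decreasing chain of `m + 1` prime `z`-filters: the filter fixed at the point lies above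
the limit of the chains at points of `X^(m - 1)` converging to it.

A point `p` of `X^(∞)` is the limit of points `u n` of `X^(n)` in `Ω`, each of which supports a
chain of length `n + 1`. The limits at `p` of selections from these chains are ordered by the
ultraproduct of the orders `Fin (n + 1)`, in which every order of size at most `𝔠` embeds, because
`I → ℕ` is separable when `I` has at most `𝔠` elements.
-/

open Filter Topology
open scoped Function

section Ultrafilters

theorem exists_ultrafilter_le_forall_eventually {X ι : Type*} {l : Filter X} {q : ι → X → Prop}
    (h : ∀ s : Finset ι, ∃ᶠ x in l, ∀ i ∈ s, q i x) :
    ∃ 𝒱 : Ultrafilter X, ↑𝒱 ≤ l ∧ ∀ i, ∀ᶠ x in 𝒱, q i x := by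
  have hne : (l ⊓ ⨅ i, 𝓟 {x | q i x}).NeBot := by
    refine inf_neBot_iff_frequently_right.2 fun {p} hp => ?_
    obtain ⟨s, hs, hsp⟩ := (hasBasis_iInf_principal_finite _).eventually_iff.1 hp
    refine (h hs.toFinset).mono fun x hx => hsp (mem_iInter₂.2 fun i hi => ?_)
    exact hx i (hs.mem_toFinset.2 hi)
  obtain ⟨𝒱, h𝒱⟩ := Ultrafilter.exists_le (l ⊓ ⨅ i, 𝓟 {x | q i x})
  refine ⟨𝒱, h𝒱.trans inf_le_left, fun i => ?_⟩
  exact h𝒱 (mem_inf_of_right (mem_iInf_of_mem i (mem_principal_self _)))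

theorem exists_injOn_restrict_finset {I V : Type*} {r : I → ℕ → V} (hr : Function.Injective r)
    (s : Finset I) : ∃ d : ℕ, InjOn (fun i (k : Fin d) => r i k) s := by
  have hsep : ∀ᶠ d : ℕ in atTop, ∀ i ∈ s, ∀ j ∈ s, i ≠ j → ∃ k < d, r i k ≠ r j k := by
    simp only [eventually_all_finset, eventually_imp_distrib_left]
    intro i _ j _ hij
    obtain ⟨k, hk⟩ := Function.ne_iff.1 (hr.ne hij)
    exact (eventually_gt_atTop k).mono fun d hd => ⟨k, hd, hk⟩
  obtain ⟨d, hd⟩ := hsep.exists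
  refine ⟨d, fun i hi j hj hij => by_contra fun hne => ?_⟩
  obtain ⟨k, hkd, hk⟩ := hd i hi j hj hne
  exact hk (congrFun hij ⟨k, hkd⟩)

/-- The Hewitt–Marczewski–Pondiczery theorem for powers of a countable discrete space: `I → V` is
separable. -/
theorem exists_seq_forall_finset_eqOn {I V : Type*} [Countable V] [Nonempty V]
    (hI : Cardinal.mk I ≤ Cardinal.continuum) :
    ∃ g : ℕ → I → V, ∀ (s : Finset I) (c : I → V), ∃ n, EqOn (g n) c s := by
  obtain ⟨r⟩ : Nonempty (I ↪ (ℕ → Bool)) := Cardinal.lift_mk_le'.1 (by simpa using hI)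
  obtain ⟨e, he⟩ := exists_surjective_nat (Σ d : ℕ, (Fin d → Bool) → V)
  refine ⟨fun n i => (e n).2 fun k => r i k, fun s c => ?_⟩
  obtain ⟨d, hd⟩ := exists_injOn_restrict_finset r.injective s
  obtain ⟨G, hG⟩ : ∃ G : (Fin d → Bool) → V, ∀ i ∈ s, G (fun k => r i k) = c i :=
    ⟨Function.extend ((s : Set I).domRestrict fun i (k : Fin d) => r i k)
      ((s : Set I).domRestrict c) fun _ => Classical.arbitrary V,
      fun i hi => hd.injective.extend_apply _ _ ⟨i, hi⟩⟩
  obtain ⟨n, hn⟩ := he ⟨d, G⟩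
  refine ⟨n, fun i hi => ?_⟩
  change (e n).2 (fun k => r i k) = c i
  rw [hn]
  exact hG i hi

theorem exists_strictMonoOn_fin_frequently {I : Type*} [Preorder I]
    (hI : Cardinal.mk I ≤ Cardinal.continuum) :
    ∃ f : I → (n : ℕ) → Fin (n + 1),
      ∀ s : Finset I, ∃ᶠ n in atTop, StrictMonoOn (fun α => f α n) s := by
  classical
  obtain ⟨g, hg⟩ := exists_seq_forall_finset_eqOn (V := ℕ) hI
  -- Unpairing makes each pattern recur at arbitrarily large `n`.
  refine ⟨fun α n => Fin.ofNat (n + 1) (g n.unpair.1 α), fun s => frequently_atTop.2 fun N => ?_⟩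
  let rank (α : I) : ℕ := (s.filter (· < α)).card
  obtain ⟨a, ha⟩ := hg s rank
  let n := Nat.pair a (max N s.card)
  have hn : max N s.card ≤ n := Nat.right_le_pair _ _
  have hval : ∀ α ∈ s, (Fin.ofNat (n + 1) (g n.unpair.1 α) : ℕ) = rank α := fun α hα => by
    have hrank : rank α ≤ n := (Finset.card_filter_le _ _).trans ((le_max_right _ _).trans hn)
    rw [Nat.unpair_pair, ha hα, Fin.val_ofNat, Nat.mod_eq_of_lt (Nat.lt_succ_of_le hrank)]
  refine ⟨n, (le_max_left _ _).trans hn, fun α hα β hβ hαβ => ?_⟩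
  simp only [Fin.lt_def, hval α hα, hval β hβ]
  refine Finset.card_lt_card ((Finset.ssubset_iff_of_subset ?_).2 ⟨α, ?_, ?_⟩)
  · exact Finset.monotone_filter_right _ fun γ _ hγ => hγ.trans hαβ
  · exact Finset.mem_filter.2 ⟨hα, hαβ⟩
  · simp

theorem exists_ultrafilter_strictMono_fin {I : Type*} [Preorder I]
    (hI : Cardinal.mk I ≤ Cardinal.continuum) :
    ∃ (f : I → (n : ℕ) → Fin (n + 1)) (𝒱 : Ultrafilter ℕ), ↑𝒱 ≤ (atTop : Filter ℕ) ∧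
      ∀ α β, α < β → ∀ᶠ n in 𝒱, f α n < f β n := by
  classical
  obtain ⟨f, hf⟩ := exists_strictMonoOn_fin_frequently hI
  obtain ⟨𝒱, h𝒱, hlt⟩ := exists_ultrafilter_le_forall_eventually (l := atTop)
    (q := fun (q : {q : I × I // q.1 < q.2}) n => f q.1.1 n < f q.1.2 n) fun s => by
      refine (hf (s.image (·.1.1) ∪ s.image (·.1.2))).mono fun n hn q hq => hn ?_ ?_ q.2
      · exact Finset.mem_union_left _ (Finset.mem_image_of_mem (·.1.1) hq)
      · exact Finset.mem_union_right _ (Finset.mem_image_of_mem (·.1.2) hq)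
  exact ⟨f, 𝒱, h𝒱, fun α β hαβ => hlt ⟨(α, β), hαβ⟩⟩

end Ultrafilters

section ZeroSets

variable {𝕜 : Type*} [RCLike 𝕜] {Ω : Type*} [TopologicalSpace Ω] {Z : Set Ω}

theorem isClosed_of_mem_zeroSets (hZ : Z ∈ zeroSets 𝕜 Ω) : IsClosed Z := by
  obtain ⟨f, rfl⟩ := hZ
  exact isClosed_eq f.continuous continuous_const

theorem univ_mem_zeroSets : univ ∈ zeroSets 𝕜 Ω :=
  ⟨0, by ext; simp [zeroSet]⟩

theorem empty_mem_zeroSets : ∅ ∈ zeroSets 𝕜 Ω :=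
  ⟨1, by ext; simp [zeroSet]⟩

theorem inter_mem_zeroSets {Z₁ Z₂ : Set Ω} (h₁ : Z₁ ∈ zeroSets 𝕜 Ω) (h₂ : Z₂ ∈ zeroSets 𝕜 Ω) :
    Z₁ ∩ Z₂ ∈ zeroSets 𝕜 Ω := by
  obtain ⟨f, rfl⟩ := h₁
  obtain ⟨g, rfl⟩ := h₂
  refine ⟨⟨fun x => ((‖f x‖ + ‖g x‖ : ℝ) : 𝕜), by fun_prop⟩, ?_⟩
  ext x
  have : ‖f x‖ + ‖g x‖ = 0 ↔ f x = 0 ∧ g x = 0 := by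
    rw [add_eq_zero_iff_of_nonneg (norm_nonneg _) (norm_nonneg _), norm_eq_zero, norm_eq_zero]
  exact this.symm.trans RCLike.ofReal_eq_zero.symm

theorem zeroSet_mem_zeroSets (f : C₀(Ω, 𝕜)) : zeroSet f ∈ zeroSets 𝕜 Ω :=
  ⟨f.toContinuousMap, rfl⟩

theorem mem_zeroSets_iff [PerfectlyNormalSpace Ω] : Z ∈ zeroSets 𝕜 Ω ↔ IsClosed Z := by
  refine ⟨isClosed_of_mem_zeroSets, fun hZ => ?_⟩
  obtain ⟨g, rfl, -⟩ := perfectlyNormalSpace_iff_forall_isClosed_preimage_zero.1 ‹_› Z hZ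
  exact ⟨⟨fun x => (g x : 𝕜), by fun_prop⟩, by ext x; simp [zeroSet]⟩

theorem exists_zeroAtInfty_zeroSet_eq_of_tendsto (g : C(Ω, ℝ))
    (hg : Tendsto g (cocompact Ω) (𝓝 0)) : ∃ f : C₀(Ω, 𝕜), zeroSet f = zeroSet g := by
  have hlim : Tendsto (fun x => (g x : 𝕜)) (cocompact Ω) (𝓝 0) := by
    simpa [Function.comp_def] using ((RCLike.continuous_ofReal (K := 𝕜)).tendsto 0).comp hg
  exact ⟨⟨⟨fun x => (g x : 𝕜), by fun_prop⟩, hlim⟩, by ext x; simp [zeroSet]⟩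

theorem exists_zeroAtInfty_zeroSet_eq [T2Space Ω] [LocallyCompactSpace Ω] (hZ : IsClosed Z)
    (hσ : IsSigmaCompact Zᶜ) : ∃ f : C₀(Ω, 𝕜), zeroSet f = Z := by
  obtain ⟨K, hK, hKZ⟩ := hσ
  let S : Set (OnePoint Ω) := ((↑) '' Zᶜ)ᶜ
  have hS : IsClosed S := (OnePoint.isOpenMap_coe _ hZ.isOpen_compl).isClosed_compl
  have hSδ : IsGδ S := by
    have : S = ⋂ n, ((↑) '' K n)ᶜ := by rw [← compl_iUnion, ← image_iUnion, hKZ]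
    exact this ▸ .iInter_of_isOpen fun n =>
      ((hK n).image OnePoint.continuous_coe).isClosed.isOpen_compl
  obtain ⟨f, hf, -, -⟩ := exists_continuous_one_zero_of_isCompact_of_isGδ hS.isCompact hSδ
    isClosed_empty (disjoint_empty _)
  let g : C(Ω, ℝ) := 1 - f.comp ⟨(↑), OnePoint.continuous_coe⟩
  have hf_infty : f ∞ = 1 := by
    have : ∞ ∈ f ⁻¹' {1} := hf ▸ OnePoint.infty_notMem_image_coe
    exact this
  have hg : Tendsto g (cocompact Ω) (𝓝 0) := by
    have := (f.continuous.tendsto ∞).comp OnePoint.tendsto_coe_infty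
    rw [coclosedCompact_eq_cocompact, hf_infty] at this
    simpa [g, Function.comp_def, Pi.sub_def] using this.const_sub 1
  have hgZ : zeroSet g = Z := by
    ext x
    have : (x : OnePoint Ω) ∈ S ↔ f x = 1 := by rw [hf]; rfl
    simp [zeroSet, g, sub_eq_zero, eq_comm (a := (1 : ℝ)), ← this, S]
  exact hgZ ▸ exists_zeroAtInfty_zeroSet_eq_of_tendsto g hg

theorem isSigmaCompact_of_isOpen_of_subset_isCompact [PerfectlyNormalSpace Ω] {K V : Set Ω}
    (hV : IsOpen V) (hK : IsCompact K) (hVK : V ⊆ K) : IsSigmaCompact V := by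
  obtain ⟨U, hU, hVU⟩ := hV.isClosed_compl.isGδ.eq_iInter_nat
  refine ⟨fun n => K \ U n, fun n => hK.diff (hU n), ?_⟩
  rw [← sdiff_iInter, ← hVU, sdiff_compl, inter_eq_right.2 hVK]

end ZeroSets

section UltraLimit

variable {ι Ω : Type*} {𝒱 : Ultrafilter ι} {P P' : ι → Set (Set Ω)}

/-- The limit of a family of collections of sets along an ultrafilter. The point is that a limit of
prime `z`-filters at points `u n` is a prime `z`-filter at the limit of `u`. -/
def ultraLimit (𝒱 : Ultrafilter ι) (P : ι → Set (Set Ω)) : Set (Set Ω) :=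
  {Z | ∀ᶠ n in 𝒱, Z ∈ P n}

theorem ultraLimit_subset (h : ∀ᶠ n in 𝒱, P n ⊆ P' n) : ultraLimit 𝒱 P ⊆ ultraLimit 𝒱 P' :=
  fun _ hZ => hZ.mp (h.mono fun _ hn => @hn _)

end UltraLimit

section ZFilters

variable {𝕜 : Type*} [RCLike 𝕜] {Ω : Type*} [TopologicalSpace Ω] {F : Set (Set Ω)}
  {Z₁ Z₂ : Set Ω} {x : Ω}

theorem IsZFilter.univ_mem (hF : IsZFilter 𝕜 F) : univ ∈ F := by
  obtain ⟨Z, hZ⟩ := hF.nonempty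
  exact hF.mem_of_superset Z hZ _ univ_mem_zeroSets (subset_univ _)

theorem IsZFilter.empty_notMem (hF : IsZFilter 𝕜 F) : ∅ ∉ F := fun h =>
  hF.ssubset.2 fun Z hZ => hF.mem_of_superset ∅ h Z hZ (empty_subset _)

theorem IsZFilter.isClosed (hF : IsZFilter 𝕜 F) {Z : Set Ω} (hZ : Z ∈ F) : IsClosed Z :=
  isClosed_of_mem_zeroSets (hF.ssubset.1 hZ)

theorem IsPrimeZFilter.mem_or_mem (hF : IsPrimeZFilter 𝕜 F) (h₁ : Z₁ ∈ zeroSets 𝕜 Ω)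
    (h₂ : Z₂ ∈ zeroSets 𝕜 Ω) (h : Z₁ ∪ Z₂ ∈ F) : Z₁ ∈ F ∨ Z₂ ∈ F := by
  by_contra! h'
  exact hF.union_notMem Z₁ ⟨h₁, h'.1⟩ Z₂ ⟨h₂, h'.2⟩ h

theorem IsPrimeZFilter.mem_of_eventuallyLE [PerfectlyNormalSpace Ω] (hF : IsPrimeZFilter 𝕜 F)
    (hx : ∀ Z ∈ F, x ∈ Z) (h₁ : Z₁ ∈ F) (h₂ : IsClosed Z₂) (h : Z₁ ≤ᶠ[𝓝 x] Z₂) : Z₂ ∈ F := by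
  let V := interior {y | y ∈ Z₁ → y ∈ Z₂}
  have hVc : IsClosed Vᶜ := isOpen_interior.isClosed_compl
  have hsub : Z₁ ⊆ Z₂ ∪ Vᶜ := fun y hy =>
    or_iff_not_imp_right.2 fun hyV => interior_subset (not_not.1 hyV) hy
  have hunion : Z₂ ∪ Vᶜ ∈ F :=
    hF.mem_of_superset Z₁ h₁ _ (mem_zeroSets_iff.2 (h₂.union hVc)) hsub
  refine (hF.mem_or_mem (mem_zeroSets_iff.2 h₂) (mem_zeroSets_iff.2 hVc) hunion).resolve_right ?_
  exact fun hV => hx _ hV (mem_interior_iff_mem_nhds.2 h)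

theorem IsPrimeZFilter.mem_iff_of_eventuallyEq [PerfectlyNormalSpace Ω]
    (hF : IsPrimeZFilter 𝕜 F) (hx : ∀ Z ∈ F, x ∈ Z) (h₁ : IsClosed Z₁) (h₂ : IsClosed Z₂)
    (h : Z₁ =ᶠ[𝓝 x] Z₂) : Z₁ ∈ F ↔ Z₂ ∈ F :=
  ⟨fun hZ => hF.mem_of_eventuallyLE hx hZ h₂ h.le,
    fun hZ => hF.mem_of_eventuallyLE hx hZ h₁ h.symm.le⟩

/-- The prime `z`-filter of all zero sets that contain the point `x`. -/
def fixedZFilter (𝕜 : Type*) [RCLike 𝕜] (x : Ω) : Set (Set Ω) :=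
  {Z ∈ zeroSets 𝕜 Ω | x ∈ Z}

theorem isPrimeZFilter_fixedZFilter (x : Ω) : IsPrimeZFilter 𝕜 (fixedZFilter 𝕜 x) where
  nonempty := ⟨univ, univ_mem_zeroSets, mem_univ x⟩
  ssubset := ⟨sep_subset _ _, fun h => (h empty_mem_zeroSets).2⟩
  inter_mem _ h₁ _ h₂ := ⟨inter_mem_zeroSets h₁.1 h₂.1, h₁.2, h₂.2⟩
  mem_of_superset _ h₁ _ h₂ h := ⟨h₂, h h₁.2⟩
  union_notMem _ h₁ _ h₂ h := h.2.elim (fun hx => h₁.2 ⟨h₁.1, hx⟩) fun hx => h₂.2 ⟨h₂.1, hx⟩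

variable {ι : Type*} {𝒱 : Ultrafilter ι} {P : ι → Set (Set Ω)}

theorem isPrimeZFilter_ultraLimit (hP : ∀ n, IsPrimeZFilter 𝕜 (P n)) :
    IsPrimeZFilter 𝕜 (ultraLimit 𝒱 P) where
  nonempty := ⟨univ, .of_forall fun n => (hP n).univ_mem⟩
  ssubset := by
    refine ⟨fun Z hZ => ?_, fun h => ?_⟩
    · obtain ⟨n, hn⟩ := Eventually.exists hZ
      exact (hP n).ssubset.1 hn
    · obtain ⟨n, hn⟩ := Eventually.exists (h (empty_mem_zeroSets (𝕜 := 𝕜)))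
      exact (hP n).empty_notMem hn
  inter_mem Z₁ h₁ Z₂ h₂ := by
    filter_upwards [h₁, h₂] with n h₁ h₂ using (hP n).inter_mem Z₁ h₁ Z₂ h₂
  mem_of_superset Z₁ h₁ Z₂ h₂ h := by
    filter_upwards [h₁] with n h₁ using (hP n).mem_of_superset Z₁ h₁ Z₂ h₂ h
  union_notMem := by
    rintro Z₁ ⟨hZ₁, h₁⟩ Z₂ ⟨hZ₂, h₂⟩ h
    obtain ⟨n, hn, hn₁, hn₂⟩ := (Eventually.and h <|
      (Ultrafilter.eventually_not.2 h₁).and (Ultrafilter.eventually_not.2 h₂)).exists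
    exact (hP n).union_notMem Z₁ ⟨hZ₁, hn₁⟩ Z₂ ⟨hZ₂, hn₂⟩ hn

theorem zFilterSupportedAt_ultraLimit [T6Space Ω] [LocallyCompactSpace Ω]
    {u : ι → Ω} (hP : ∀ n, IsPrimeZFilter 𝕜 (P n) ∧ ZFilterSupportedAt (P n) (u n : OnePoint Ω))
    {p : OnePoint Ω} (hu : Tendsto (fun n => (u n : OnePoint Ω)) 𝒱 (𝓝 p)) :
    ZFilterSupportedAt (ultraLimit 𝒱 P) p := by
  have hlim := isPrimeZFilter_ultraLimit (𝒱 := 𝒱) fun n => (hP n).1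
  induction p using OnePoint.rec with
  | coe x =>
    have hux : Tendsto u 𝒱 (𝓝 x) := by rwa [← OnePoint.comap_coe_nhds, tendsto_comap_iff]
    exact fun Z hZ => (hlim.isClosed hZ).mem_of_tendsto hux (hZ.mono fun n hn => (hP n).2 Z hn)
  | infty =>
    rintro ⟨x, hx⟩
    obtain ⟨K, hK, hxK⟩ := exists_compact_mem_nhds x
    refine hx (interior K)ᶜ ?_ (mem_interior_iff_mem_nhds.2 hxK)
    have hu_cocompact : Tendsto u 𝒱 (cocompact Ω) := by
      rwa [← coclosedCompact_eq_cocompact, ← OnePoint.comap_coe_nhds_infty, tendsto_comap_iff]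
    filter_upwards [hu_cocompact hK.compl_mem_cocompact] with n hn
    refine (hP n).1.mem_of_eventuallyLE (hP n).2 (hP n).1.univ_mem
      isOpen_interior.isClosed_compl ?_
    filter_upwards [hK.isClosed.isOpen_compl.mem_nhds hn] with y hy _ hyK
    exact hy (interior_subset hyK)

end ZFilters

section SeparatedFamilies

variable {𝕜 : Type*} [RCLike 𝕜] {Ω ι : Type*} [TopologicalSpace Ω]

/-- A family of points with pairwise disjoint compact neighbourhoods. Prescribing a germ of a closed
set at each of its points then amounts to prescribing one zero set; see
`CompactlySeparated.exists_zeroSet_eventuallyEq`. -/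
def CompactlySeparated (u : ι → Ω) : Prop :=
  ∃ K : ι → Set Ω, (∀ n, IsCompact (K n)) ∧ (∀ n, K n ∈ 𝓝 (u n)) ∧ Pairwise (Disjoint on K)

theorem exists_strictMono_compactlySeparated_comp [T2Space Ω] [LocallyCompactSpace Ω]
    {p : OnePoint Ω} {u : ℕ → Ω} (hu : Tendsto (fun n => (u n : OnePoint Ω)) atTop (𝓝[≠] p)) :
    ∃ φ : ℕ → ℕ, StrictMono φ ∧ CompactlySeparated (u ∘ φ) := by
  let IsNhd (q : ℕ × Set Ω) : Prop :=
    IsCompact q.2 ∧ q.2 ∈ 𝓝 (u q.1) ∧ p ∉ ((↑) : Ω → OnePoint Ω) '' q.2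
  have extend (s : Finset (ℕ × Set Ω)) (hs : ∀ q ∈ s, IsNhd q) :
      ∃ q', IsNhd q' ∧ ∀ q ∈ s, q.1 < q'.1 ∧ Disjoint q.2 q'.2 := by
    let O : Set (OnePoint Ω) := ⋂ q ∈ s, (((↑) : Ω → OnePoint Ω) '' q.2)ᶜ
    have hO : IsOpen O := isOpen_biInter_finset fun q hq =>
      ((hs q hq).1.image OnePoint.continuous_coe).isClosed.isOpen_compl
    have hpO : p ∈ O := mem_iInter₂.2 fun q hq => (hs q hq).2.2
    have huO : ∀ᶠ n in atTop, (u n : OnePoint Ω) ∈ O \ {p} :=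
      hu.eventually (sdiff_mem_nhdsWithin_compl (hO.mem_nhds hpO) {p})
    have hlarge : ∀ᶠ n in atTop, ∀ q ∈ s, q.1 < n :=
      (eventually_all_finset s).2 fun q _ => eventually_gt_atTop q.1
    obtain ⟨n, hn, hns⟩ := (huO.and hlarge).exists
    obtain ⟨K, hK, hKO, hKc⟩ := local_compact_nhds
      (((hO.sdiff isClosed_singleton).preimage OnePoint.continuous_coe).mem_nhds hn)
    refine ⟨(n, K), ⟨hKc, hK, fun ⟨y, hy, hyp⟩ => (hKO hy).2 hyp⟩, fun q hq => ⟨hns q hq, ?_⟩⟩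
    exact disjoint_right.2 fun y hy hyq => mem_iInter₂.1 (hKO hy).1 q hq ⟨y, hyq, rfl⟩
  obtain ⟨q, hq, hqs⟩ := exists_seq_of_forall_finset_exists IsNhd
    (fun q q' => q.1 < q'.1 ∧ Disjoint q.2 q'.2) extend
  refine ⟨fun n => (q n).1, fun m n hmn => (hqs m n hmn).1, fun n => (q n).2,
    fun n => (hq n).1, fun n => (hq n).2.1, ?_⟩
  exact (pairwise_disjoint_on _).2 fun m n hmn => (hqs m n hmn).2

theorem CompactlySeparated.exists_zeroSet_eventuallyEq [Countable ι] [T6Space Ω]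
    [LocallyCompactSpace Ω] {u : ι → Ω} (hu : CompactlySeparated u) {C : ι → Set Ω}
    (hC : ∀ n, IsClosed (C n)) : ∃ h : C₀(Ω, 𝕜), ∀ n, zeroSet h =ᶠ[𝓝 (u n)] C n := by
  obtain ⟨K, hK, hKu, hd⟩ := hu
  let Z : Set Ω := ⋂ n, (C n ∪ (interior (K n))ᶜ)
  have hcl (n : ι) : IsClosed (C n ∪ (interior (K n))ᶜ) :=
    (hC n).union isOpen_interior.isClosed_compl
  have hσ : IsSigmaCompact Zᶜ := by
    rw [compl_iInter]
    refine isSigmaCompact_iUnion _ fun n =>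
      isSigmaCompact_of_isOpen_of_subset_isCompact (hcl n).isOpen_compl (hK n) ?_
    rw [compl_union, compl_compl]
    exact inter_subset_right.trans interior_subset
  obtain ⟨h, hh⟩ := exists_zeroAtInfty_zeroSet_eq (𝕜 := 𝕜) (isClosed_iInter hcl) hσ
  refine ⟨h, fun n => hh ▸ ?_⟩
  filter_upwards [interior_mem_nhds.2 (hKu n)] with y hy
  refine propext ⟨fun hyZ => (mem_iInter.1 hyZ n).resolve_right (not_not.2 hy), fun hyC => ?_⟩
  refine mem_iInter.2 fun m => ?_
  rcases eq_or_ne m n with rfl | hmn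
  · exact Or.inl hyC
  · exact Or.inr fun hym =>
      disjoint_left.1 (hd hmn) (interior_subset hym) (interior_subset hy)

section SeparatedUltraLimit

variable [Countable ι] [T6Space Ω] [LocallyCompactSpace Ω] {𝒱 : Ultrafilter ι}
  {P P' : ι → Set (Set Ω)} {u : ι → Ω}

theorem CompactlySeparated.exists_zeroSet_mem_iff (hu : CompactlySeparated u) {C : ι → Set Ω}
    (hC : ∀ n, IsClosed (C n)) :
    ∃ h : C₀(Ω, 𝕜), ∀ n F, IsPrimeZFilter 𝕜 F ∧ ZFilterSupportedAt F (u n : OnePoint Ω) →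
      (zeroSet h ∈ F ↔ C n ∈ F) := by
  obtain ⟨h, hh⟩ := hu.exists_zeroSet_eventuallyEq (𝕜 := 𝕜) hC
  refine ⟨h, fun n F hF => hF.1.mem_iff_of_eventuallyEq hF.2 ?_ (hC n) (hh n)⟩
  exact isClosed_of_mem_zeroSets (zeroSet_mem_zeroSets h)

theorem CompactlySeparated.zInvC₀_ultraLimit_ne_univ (hu : CompactlySeparated u)
    (hP : ∀ n, IsPrimeZFilter 𝕜 (P n) ∧ ZFilterSupportedAt (P n) (u n : OnePoint Ω)) :
    zInvC₀ 𝕜 (ultraLimit 𝒱 P) ≠ univ := by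
  obtain ⟨h, hh⟩ := hu.exists_zeroSet_mem_iff (𝕜 := 𝕜) fun _ => isClosed_empty
  intro huniv
  have hmem : ∀ᶠ n in 𝒱, zeroSet h ∈ P n := huniv.ge (mem_univ h)
  obtain ⟨n, hn⟩ := hmem.exists
  exact (hP n).1.empty_notMem ((hh n _ (hP n)).1 hn)

theorem CompactlySeparated.zInvC₀_ultraLimit_ssubset (hu : CompactlySeparated u)
    (hP : ∀ n, IsPrimeZFilter 𝕜 (P n) ∧ ZFilterSupportedAt (P n) (u n : OnePoint Ω))
    (hP' : ∀ n, IsPrimeZFilter 𝕜 (P' n) ∧ ZFilterSupportedAt (P' n) (u n : OnePoint Ω))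
    (hlt : ∀ᶠ n in 𝒱, P n ⊂ P' n) :
    zInvC₀ 𝕜 (ultraLimit 𝒱 P) ⊂ zInvC₀ 𝕜 (ultraLimit 𝒱 P') := by
  have hC (n : ι) : ∃ C, IsClosed C ∧ (P n ⊂ P' n → C ∈ P' n ∧ C ∉ P n) := by
    by_cases hn : P n ⊂ P' n
    · obtain ⟨C, hC', hC⟩ := exists_of_ssubset hn
      exact ⟨C, (hP' n).1.isClosed hC', fun _ => ⟨hC', hC⟩⟩
    · exact ⟨∅, isClosed_empty, fun h => absurd h hn⟩
  choose C hC hCP using hC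
  obtain ⟨h, hh⟩ := hu.exists_zeroSet_mem_iff (𝕜 := 𝕜) hC
  have hsub : ultraLimit 𝒱 P ⊆ ultraLimit 𝒱 P' :=
    ultraLimit_subset (hlt.mono fun n => subset_of_ssubset)
  have hhP' : h ∈ zInvC₀ 𝕜 (ultraLimit 𝒱 P') :=
    hlt.mono fun n hn => (hh n _ (hP' n)).2 (hCP n hn).1
  refine ⟨fun f hf => hsub hf, fun hle => ?_⟩
  have hmem : ∀ᶠ n in 𝒱, zeroSet h ∈ P n := hle hhP'
  obtain ⟨n, hn, hmemn⟩ := (hlt.and hmem).exists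
  exact (hCP n hn).2 ((hh n _ (hP n)).1 hmemn)

theorem CompactlySeparated.ultraLimit_ssubset (hu : CompactlySeparated u)
    (hP : ∀ n, IsPrimeZFilter 𝕜 (P n) ∧ ZFilterSupportedAt (P n) (u n : OnePoint Ω))
    (hP' : ∀ n, IsPrimeZFilter 𝕜 (P' n) ∧ ZFilterSupportedAt (P' n) (u n : OnePoint Ω))
    (hlt : ∀ᶠ n in 𝒱, P n ⊂ P' n) : ultraLimit 𝒱 P ⊂ ultraLimit 𝒱 P' := by
  refine ⟨ultraLimit_subset (hlt.mono fun n => subset_of_ssubset), fun hle => ?_⟩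
  exact (hu.zInvC₀_ultraLimit_ssubset hP hP' hlt).2 fun f hf => hle hf

end SeparatedUltraLimit

end SeparatedFamilies

section Sequences

theorem exists_seq_tendsto_forall {X : Type*} {l : Filter X} [l.IsCountablyGenerated]
    {q : ℕ → X → Prop} (h : ∀ n, ∃ᶠ x in l, q n x) :
    ∃ u : ℕ → X, (∀ n, q n (u n)) ∧ Tendsto u atTop l := by
  obtain ⟨B, hB⟩ := l.exists_antitone_basis
  choose u hu huB using fun n => ((h n).and_eventually (hB.mem n)).exists
  exact ⟨u, hu, hB.tendsto huB⟩

variable {Ω : Type*} [TopologicalSpace Ω]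

theorem tendsto_cocompact_of_forall_not_mapClusterPt {ι : Type*} {l : Filter ι} {u : ι → Ω}
    (hu : ∀ x, ¬ MapClusterPt x l u) : Tendsto u l (cocompact Ω) := by
  refine hasBasis_cocompact.tendsto_right_iff.2 fun K hK => ?_
  by_contra h
  obtain ⟨x, -, hx⟩ := hK.exists_mapClusterPt_of_frequently
    ((not_eventually.1 h).mono fun _ => not_not.1)
  exact hu x hx

theorem exists_seq_tendsto_cocompact_of_not_isCompact [TopologicalSpace.PseudoMetrizableSpace Ω]
    {T : Set Ω} (hT : IsClosed T) (hTc : ¬ IsCompact T) :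
    ∃ u : ℕ → Ω, (∀ n, u n ∈ T) ∧ Tendsto u atTop (cocompact Ω) := by
  let := TopologicalSpace.pseudoMetrizableSpacePseudoMetric Ω
  rw [isCompact_iff_isSeqCompact, IsSeqCompact] at hTc
  push Not at hTc
  obtain ⟨u, hu, hconv⟩ := hTc
  refine ⟨u, hu, tendsto_cocompact_of_forall_not_mapClusterPt fun x hx => ?_⟩
  obtain ⟨φ, hφ, hlim⟩ := hx.tendsto_subseq
  exact hconv x (hT.mem_of_tendsto hlim (.of_forall fun n => hu _)) φ hφ hlim

theorem exists_seq_tendsto_cocompact [TopologicalSpace.PseudoMetrizableSpace Ω]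
    [WeaklyLocallyCompactSpace Ω] {T : ℕ → Set Ω} (hanti : Antitone T) (hT : ∀ n, IsClosed (T n))
    (hfreq : ∀ n, ∃ᶠ x in cocompact Ω, x ∈ T n) :
    ∃ u : ℕ → Ω, (∀ n, u n ∈ T n) ∧ Tendsto u atTop (cocompact Ω) := by
  by_cases hTc : IsCompact (⋂ n, T n)
  · obtain ⟨W, hW, hTW⟩ := exists_compact_superset hTc
    -- A cluster point of `u` would lie in the intersection, hence in the interior of `W`.
    choose u hu huW using fun n => ((hfreq n).and_eventually hW.compl_mem_cocompact).exists
    refine ⟨u, hu, tendsto_cocompact_of_forall_not_mapClusterPt fun x hx => ?_⟩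
    have hxT : x ∈ ⋂ n, T n := mem_iInter.2 fun n =>
      (hT n).mem_of_mapClusterPt hx ((eventually_ge_atTop n).mono fun m hm => hanti hm (hu m))
    have hxW : ∃ᶠ n in atTop, u n ∈ W :=
      hx.frequently (mem_interior_iff_mem_nhds.1 (hTW hxT))
    exact hxW (.of_forall huW)
  · obtain ⟨u, hu, hlim⟩ := exists_seq_tendsto_cocompact_of_not_isCompact (isClosed_iInter hT) hTc
    exact ⟨u, fun n => mem_iInter.1 (hu n) n, hlim⟩

theorem exists_seq_tendsto_nhdsNE_of_accPt [TopologicalSpace.PseudoMetrizableSpace Ω]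
    [WeaklyLocallyCompactSpace Ω] {p : OnePoint Ω} {Y : ℕ → Set (OnePoint Ω)} (hanti : Antitone Y)
    (hY : ∀ n, IsClosed (Y n)) (hp : ∀ n, AccPt p (𝓟 (Y n))) :
    ∃ u : ℕ → Ω, (∀ n, (u n : OnePoint Ω) ∈ Y n) ∧
      Tendsto (fun n => (u n : OnePoint Ω)) atTop (𝓝[≠] p) := by
  have hfreq : ∀ n, ∃ᶠ y in 𝓝[≠] p, y ∈ Y n := fun n => accPt_iff_frequently_nhdsNE.1 (hp n)
  induction p using OnePoint.rec with
  | coe x =>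
    have hnhds : 𝓝[≠] (x : OnePoint Ω) = map (↑) (𝓝[≠] x) := by
      rw [OnePoint.nhdsWithin_coe, preimage_compl, ← image_singleton,
        preimage_image_eq _ OnePoint.coe_injective]
    simp only [hnhds, frequently_map] at hfreq
    obtain ⟨u, huY, hu⟩ := exists_seq_tendsto_forall hfreq
    exact ⟨u, huY, hnhds ▸ tendsto_map.comp hu⟩
  | infty =>
    rw [OnePoint.nhdsNE_infty_eq, coclosedCompact_eq_cocompact] at hfreq ⊢
    obtain ⟨u, huY, hu⟩ := exists_seq_tendsto_cocompact
      (fun _ _ hmn => preimage_mono (hanti hmn)) (fun n => (hY n).preimage OnePoint.continuous_coe)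
      fun n => frequently_map.1 (hfreq n)
    exact ⟨u, huY, tendsto_map.comp hu⟩

theorem exists_compactlySeparated_seq_of_accPt [TopologicalSpace.MetrizableSpace Ω]
    [LocallyCompactSpace Ω] {p : OnePoint Ω} {Y : ℕ → Set (OnePoint Ω)} (hanti : Antitone Y)
    (hY : ∀ n, IsClosed (Y n)) (hp : ∀ n, AccPt p (𝓟 (Y n))) :
    ∃ u : ℕ → Ω, CompactlySeparated u ∧ (∀ n, (u n : OnePoint Ω) ∈ Y n) ∧
      Tendsto (fun n => (u n : OnePoint Ω)) atTop (𝓝[≠] p) := by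
  obtain ⟨u, huY, hu⟩ := exists_seq_tendsto_nhdsNE_of_accPt hanti hY hp
  obtain ⟨φ, hφ, hsep⟩ := exists_strictMono_compactlySeparated_comp hu
  exact ⟨u ∘ φ, hsep, fun n => hanti (hφ.id_le n) (huY (φ n)), hu.comp hφ.tendsto_atTop⟩

end Sequences

section Chains

theorem isClosed_cbLevel (X : Type*) [TopologicalSpace X] [T1Space X] :
    ∀ n, IsClosed (cbLevel X n)
  | 0 => isClosed_univ
  | _ + 1 => isClosed_derivedSet _

theorem antitone_cbLevel (X : Type*) [TopologicalSpace X] [T1Space X] : Antitone (cbLevel X) :=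
  antitone_nat_of_succ_le fun n =>
    (isClosed_iff_derivedSet_subset _).1 (isClosed_cbLevel X n)

variable (𝕜 : Type*) [RCLike 𝕜] {Ω : Type*} [TopologicalSpace Ω]
  [TopologicalSpace.MetrizableSpace Ω] [LocallyCompactSpace Ω]

theorem exists_strictAnti_primeZFilters (m : ℕ) (x : Ω)
    (hx : (x : OnePoint Ω) ∈ cbLevel (OnePoint Ω) m) :
    ∃ P : Fin (m + 1) → Set (Set Ω), StrictAnti P ∧
      ∀ j, IsPrimeZFilter 𝕜 (P j) ∧ ZFilterSupportedAt (P j) (x : OnePoint Ω) := by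
  induction m generalizing x with
  | zero =>
    exact ⟨fun _ => fixedZFilter 𝕜 x, Subsingleton.strictAnti (α := Fin 1) _,
      fun _ => ⟨isPrimeZFilter_fixedZFilter x, fun Z hZ => hZ.2⟩⟩
  | succ m ih =>
    obtain ⟨u, hsep, hu, hlim⟩ := exists_compactlySeparated_seq_of_accPt antitone_const
      (fun _ => isClosed_cbLevel (OnePoint Ω) m) (fun _ => hx)
    choose P hanti hP using fun k => ih (u k) (hu k)
    let Q (j : Fin (m + 1)) : Set (Set Ω) := ultraLimit (hyperfilter ℕ) fun k => P k j
    have hlim' := hlim.mono_left Nat.hyperfilter_le_atTop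
    have hQ (j) : IsPrimeZFilter 𝕜 (Q j) ∧ ZFilterSupportedAt (Q j) (x : OnePoint Ω) :=
      ⟨isPrimeZFilter_ultraLimit fun k => (hP k j).1,
        zFilterSupportedAt_ultraLimit (fun k => hP k j) (hlim'.mono_right nhdsWithin_le_nhds)⟩
    have hQanti : StrictAnti Q := fun i j hij =>
      hsep.ultraLimit_ssubset (fun k => hP k j) (fun k => hP k i) (.of_forall fun k => hanti k hij)
    have hQ_lt : Q 0 < fixedZFilter 𝕜 x := by
      refine ⟨fun Z hZ => ⟨(hQ 0).1.ssubset.1 hZ, (hQ 0).2 Z hZ⟩, fun hle => ?_⟩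
      have hsingle : ∀ᶠ k in hyperfilter ℕ, {x} ∈ P k 0 :=
        hle ⟨mem_zeroSets_iff.2 isClosed_singleton, rfl⟩
      obtain ⟨k, hk, hne⟩ := (hsingle.and (hlim'.eventually self_mem_nhdsWithin)).exists
      exact hne (congrArg _ ((hP k 0).2 _ hk))
    refine ⟨Matrix.vecCons (fixedZFilter 𝕜 x) Q, strictAnti_vecCons.2 ⟨hQ_lt, hQanti⟩, ?_⟩
    exact Fin.cons ⟨isPrimeZFilter_fixedZFilter x, fun Z hZ => hZ.2⟩ hQ

end Chains

section Ideals

variable {𝕜 : Type*} [RCLike 𝕜] {Ω : Type*} [TopologicalSpace Ω] {F : Set (Set Ω)}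

theorem IsPrimeZFilter.isPrimeZIdeal_zInvC₀ (hF : IsPrimeZFilter 𝕜 F)
    (hne : zInvC₀ 𝕜 F ≠ univ) : IsPrimeZIdeal (zInvC₀ 𝕜 F) := by
  have hsub (f g : C₀(Ω, 𝕜)) (hf : zeroSet f ∈ F) (h : zeroSet f ⊆ zeroSet g) : zeroSet g ∈ F :=
    hF.mem_of_superset _ hf _ (zeroSet_mem_zeroSets g) h
  refine { zero_mem := ?_, add_mem := fun f hf g hg => ?_, smul_mem := fun c f hf => ?_,
           mul_mem := fun g f hf => ?_, ne_univ := hne, mem_or_mem := fun f g hfg => ?_,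
           mem_of_zeroSet_subset := fun f hf g h => hsub f g hf h }
  · exact hF.mem_of_superset _ hF.univ_mem _ (zeroSet_mem_zeroSets 0) fun x _ => rfl
  · refine hF.mem_of_superset _ (hF.inter_mem _ hf _ hg) _ (zeroSet_mem_zeroSets (f + g)) ?_
    rintro x ⟨hfx : f x = 0, hgx : g x = 0⟩
    simp [zeroSet, hfx, hgx]
  · refine hsub f (c • f) hf fun x (hfx : f x = 0) => ?_
    simp [zeroSet, hfx]
  · refine hsub f (g * f) hf fun x (hfx : f x = 0) => ?_
    simp [zeroSet, hfx]
  · have hunion : zeroSet (f * g : C₀(Ω, 𝕜)) = zeroSet f ∪ zeroSet g := by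
      ext x
      simp [zeroSet]
    exact hF.mem_or_mem (zeroSet_mem_zeroSets f) (zeroSet_mem_zeroSets g) (hunion ▸ hfg)

theorem IsZFilter.idealSupportedAt_zInvC₀ [RegularSpace Ω] [LocallyCompactSpace Ω]
    (hF : IsZFilter 𝕜 F) {p : OnePoint Ω} (hp : ZFilterSupportedAt F p) :
    IdealSupportedAt (zInvC₀ 𝕜 F) p := by
  induction p using OnePoint.rec with
  | coe x => exact fun f hf => hp _ hf
  | infty =>
    rintro ⟨x, hx⟩
    refine hp ⟨x, fun Z hZ => by_contra fun hxZ => ?_⟩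
    obtain ⟨g, hg_one, hg_zero, hg_supp, -⟩ := exists_continuous_one_zero_of_isCompact
      isCompact_singleton (hF.isClosed hZ) (disjoint_singleton_left.2 hxZ)
    obtain ⟨f, hf⟩ := exists_zeroAtInfty_zeroSet_eq_of_tendsto (𝕜 := 𝕜) g
      hg_supp.is_zero_at_infty
    have hfF : zeroSet f ∈ F :=
      hF.mem_of_superset Z hZ _ (zeroSet_mem_zeroSets f) (hf ▸ hg_zero)
    have hgx : x ∈ zeroSet g := hf ▸ hx f hfF
    exact one_ne_zero ((hg_one rfl).symm.trans hgx)

end Ideals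

theorem theorem4p2_general (𝕜 : Type*) [RCLike 𝕜] {Ω : Type*} [TopologicalSpace Ω]
    [TopologicalSpace.MetrizableSpace Ω] [LocallyCompactSpace Ω]
    {I : Type*} [Preorder I] (hI : Cardinal.mk I ≤ Cardinal.continuum)
    (p : OnePoint Ω) (hp : p ∈ cbLevelInfty (OnePoint Ω)) :
    ∃ 𝒬 : I → Set (Set Ω),
      StrictAnti 𝒬 ∧
      (∀ α, IsPrimeZFilter 𝕜 (𝒬 α) ∧ ZFilterSupportedAt (𝒬 α) p) ∧
      StrictAnti (fun α => zInvC₀ 𝕜 (𝒬 α)) ∧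
      (∀ α, IsPrimeZIdeal (zInvC₀ 𝕜 (𝒬 α)) ∧ IdealSupportedAt (zInvC₀ 𝕜 (𝒬 α)) p) := by
  obtain ⟨u, hsep, hu, hlim⟩ := exists_compactlySeparated_seq_of_accPt
    (antitone_cbLevel (OnePoint Ω)) (isClosed_cbLevel _) fun n => mem_iInter.1 hp n
  choose P hanti hP using fun n => exists_strictAnti_primeZFilters 𝕜 n (u n) (hu n)
  obtain ⟨f, 𝒱, h𝒱, hf⟩ := exists_ultrafilter_strictMono_fin hI
  let 𝒬 (α : I) : Set (Set Ω) := ultraLimit 𝒱 fun n => P n (f α n)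
  have hlt (α β : I) (hαβ : α < β) : ∀ᶠ n in 𝒱, P n (f β n) ⊂ P n (f α n) :=
    (hf α β hαβ).mono fun n hn => hanti n hn
  have hprime (α : I) : IsPrimeZFilter 𝕜 (𝒬 α) :=
    isPrimeZFilter_ultraLimit fun n => (hP n (f α n)).1
  have hsupp (α : I) : ZFilterSupportedAt (𝒬 α) p :=
    zFilterSupportedAt_ultraLimit (fun n => hP n (f α n))
      ((hlim.mono_left h𝒱).mono_right nhdsWithin_le_nhds)
  refine ⟨𝒬, fun α β hαβ => ?_, fun α => ⟨hprime α, hsupp α⟩, fun α β hαβ => ?_, fun α => ⟨?_, ?_⟩⟩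
  · exact hsep.ultraLimit_ssubset (fun n => hP n _) (fun n => hP n _) (hlt α β hαβ)
  · exact hsep.zInvC₀_ultraLimit_ssubset (fun n => hP n _) (fun n => hP n _) (hlt α β hαβ)
  · exact (hprime α).isPrimeZIdeal_zInvC₀ (hsep.zInvC₀_ultraLimit_ne_univ fun n => hP n _)
  · exact (hprime α).idealSupportedAt_zInvC₀ (hsupp α)

theorem theorem4p2 (𝕜 : Type*) [RCLike 𝕜] {Ω : Type*} [TopologicalSpace Ω]
    [TopologicalSpace.MetrizableSpace Ω] [LocallyCompactSpace Ω]
    (p : OnePoint Ω) (hp : p ∈ cbLevelInfty (OnePoint Ω)) :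
    ∃ 𝒬 : Set.Iio (Cardinal.continuum.{0}).ord → Set (Set Ω),
      StrictAnti 𝒬 ∧
      (∀ α, IsPrimeZFilter 𝕜 (𝒬 α) ∧ ZFilterSupportedAt (𝒬 α) p) ∧
      StrictAnti (fun α => zInvC₀ 𝕜 (𝒬 α)) ∧
      (∀ α, IsPrimeZIdeal (zInvC₀ 𝕜 (𝒬 α)) ∧ IdealSupportedAt (zInvC₀ 𝕜 (𝒬 α)) p) :=
  theorem4p2_general 𝕜 (by simp [Cardinal.mk_Iio_ordinal]) p hp
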